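/- Theorem 1. Let $b$ be a positive integer and, for $0<t<1$, let $$f_b(t)=2\sum_{n=0}^{\infty}(-1)^n q^{n^2+bn},\qquad q=\frac{1-t}{1+t}.$$ Then there is a unique real sequence $(a_n)_{n\ge 0}$ such that $f_b(t)\sim\sum_{n\ge 0}a_nt^n$ as $t\to 0^+$, that is, such that for every integer $N\ge 0$, $f_b(t)-\sum_{n=0}^{N}a_nt^n=o(t^N)$ as $t\to 0^+$. The coefficients $a_n$ eventually all have the same strict sign (the Berndt–Kim conjecture): either $a_n>0$ for all sufficiently large $n$, or $a_n<0$ for all sufficiently large $n$. More precisely, if $b\equiv 1$ or $2\pmod 4$, then $a_n>0$ for all sufficiently large $n$, and if $b\equiv 0$ or $3\pmod 4$, then $a_n<0$ for all sufficiently large $n$. -/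

import Mathlib

open Filter Topology Asymptotics

/-- The partial theta function `f_b(t) = 2 ∑_{n ≥ 0} (-1)^n q^(n² + b n)` with
`q = (1 - t) / (1 + t)`. For `0 < t < 1` one has `0 < q < 1` and the series converges absolutely. -/
noncomputable def partialTheta (b : ℕ) (t : ℝ) : ℝ :=
  2 * ∑' n : ℕ, (-1 : ℝ) ^ n * ((1 - t) / (1 + t)) ^ (n ^ 2 + b * n)

/-- Absolute convergence of the defining series of `partialTheta` for `0 < t < 1`. -/
theorem summable_partialTheta (b : ℕ) {t : ℝ} (h0 : 0 < t) (h1 : t < 1) :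
    Summable fun n : ℕ => (-1 : ℝ) ^ n * ((1 - t) / (1 + t)) ^ (n ^ 2 + b * n) := by
  have hq0 : 0 ≤ (1 - t) / (1 + t) := div_nonneg (by linarith) (by linarith)
  have hq1 : (1 - t) / (1 + t) < 1 := by
    rw [div_lt_one (by linarith)]
    linarith
  refine Summable.of_norm_bounded (summable_geometric_of_lt_one hq0 hq1) fun n => ?_
  rw [norm_mul, norm_pow, norm_neg, norm_one, one_pow, one_mul, Real.norm_eq_abs,
    abs_of_nonneg (pow_nonneg hq0 _)]
  exact pow_le_pow_of_le_one hq0 hq1.le (by nlinarith [Nat.zero_le (b * n)])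

/-- `f(t) ∼ ∑_{n ≥ 0} a_n t^n` as `t → 0⁺`, in the sense of Poincaré: for every `N`,
`f(t) - ∑_{n ≤ N} a_n t^n = o(t^N)` as `t → 0⁺`. -/
def HasAsymptoticExpansion (f : ℝ → ℝ) (a : ℕ → ℝ) : Prop :=
  ∀ N : ℕ, (fun t : ℝ => f t - ∑ n ∈ Finset.range (N + 1), a n * t ^ n)
    =o[𝓝[>] (0 : ℝ)] fun t : ℝ => t ^ N

/-! Put `w = log ((1 + t) / (1 - t))`, so `q = exp (-w)`. Completing the square gives `f_b = exp (w
b² / 4) * 2 ∑ (-1)^n exp (-w (n + b/2)²)`, and removing the term `n = 0` gives `f_{b+2} = ((1 + t) /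
(1 - t))^(b+1) * (2 - f_b)`. The recursion flips the sign at each step, so only `b = 1`, `b = 2` and
the growth of coefficients matter.

For the base cases take `w = 2δ²` and sample `g(y) = exp (-y²/2)` at spacing `2δ`. If `U(y+δ) +
U(y-δ) = g(y)`, the alternating sum telescopes to one value of `U`. Formally `U = (2 cosh (δD))⁻¹
g`; a truncation of this solves the equation up to a summable error of high order in `δ`
(`exists_abs_tsum_sub_gaussHalfSum_le`). For `b = 1` the value is `U(0)`: the signs of sech and of
the Gaussian derivatives at `0` cancel, leaving positive coefficients of factorial size
(`coeff_thetaOneSeries_nonneg_and_ge`). For `b = 2` it is `U(δ)`, with `2U(δ) = U(δ) + U(-δ) ≈ 1`,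
so `f_2` has the expansion of `(1 + t) / (1 - t)`.

Iterating, `f_{b+2m}` is `(-1)^m` times a power of `(1 + t) / (1 - t)` times the base series, plus
an error dominated by such a power. For odd `b`, factorial growth beats the error, which is at most
geometric; for even `b`, the main term has one more factor `(1 + t) / (1 - t)`, hence coefficients
of larger order. -/

open scoped Nat

/-! ### One-sided asymptotic expansions: uniqueness, algebra, composition. -/

/-- `f` has the formal power series `P` as its one-sided asymptotic expansion at `0`. -/
def HasSeriesExpansion (f : ℝ → ℝ) (P : PowerSeries ℝ) : Prop :=
  ∀ N : ℕ, (fun t : ℝ => f t - (P.trunc N).eval t) =O[𝓝[>] (0 : ℝ)] fun t : ℝ => t ^ N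

theorem eval_trunc_eq_sum (P : PowerSeries ℝ) (N : ℕ) (t : ℝ) :
    (P.trunc N).eval t = ∑ n ∈ Finset.range N, P.coeff n * t ^ n := by
  simpa using PowerSeries.eval₂_trunc_eq_sum_range t (RingHom.id ℝ) N P

theorem isLittleO_pow_succ (N : ℕ) :
    (fun t : ℝ => t ^ (N + 1)) =o[𝓝[>] (0 : ℝ)] fun t : ℝ => t ^ N :=
  (isLittleO_pow_pow (Nat.lt_succ_self N)).mono nhdsWithin_le_nhds

theorem isBigO_eval_of_X_pow_dvd {p : Polynomial ℝ} {N : ℕ} (h : Polynomial.X ^ N ∣ p) :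
    (fun t : ℝ => p.eval t) =O[𝓝[>] (0 : ℝ)] fun t : ℝ => t ^ N := by
  obtain ⟨q, rfl⟩ := h
  have hq : (fun t : ℝ => q.eval t) =O[𝓝[>] (0 : ℝ)] fun _ => (1 : ℝ) :=
    (q.continuous.continuousAt.isBigO_one ℝ).mono nhdsWithin_le_nhds
  simpa using (isBigO_refl (fun t : ℝ => t ^ N) _).mul hq

/-- The two forms differ by a shift: an `o(t^N)` remainder after degree `N` comes from the
`O(t^(N+1))` one, and conversely the term of degree `N` is itself `O(t^N)`. The big-O form is easier
to multiply and compose. -/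
theorem hasAsymptoticExpansion_iff {f : ℝ → ℝ} {P : PowerSeries ℝ} :
    HasAsymptoticExpansion f (fun n => P.coeff n) ↔ HasSeriesExpansion f P := by
  constructor
  · intro h N
    have h1 := (h N).isBigO
    refine (h1.add ((isBigO_refl (fun t : ℝ => t ^ N) (𝓝[>] (0 : ℝ))).const_mul_left
      (P.coeff N))).congr_left fun t => ?_
    rw [eval_trunc_eq_sum, Finset.sum_range_succ]; ring
  · intro h N
    refine ((h (N + 1)).trans_isLittleO (isLittleO_pow_succ N)).congr_left fun t => ?_
    rw [eval_trunc_eq_sum]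

theorem HasAsymptoticExpansion.unique {f : ℝ → ℝ} {a b : ℕ → ℝ}
    (ha : HasAsymptoticExpansion f a) (hb : HasAsymptoticExpansion f b) : a = b := by
  funext n
  induction n using Nat.strong_induction_on with
  | _ n ih =>
    have h := (hb n).sub (ha n)
    have h' : (fun t : ℝ => (a n - b n) * t ^ n) =o[𝓝[>] (0 : ℝ)] fun t : ℝ => t ^ n := by
      refine h.congr_left fun t => ?_
      rw [Finset.sum_range_succ, Finset.sum_range_succ, Finset.sum_congr rfl fun i hi => show a i * t ^ i = b i * t ^ i by
        rw [ih i (Finset.mem_range.1 hi)]]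
      ring
    by_contra hne
    have hc : a n - b n ≠ 0 := sub_ne_zero.2 hne
    rw [isLittleO_const_mul_left_iff hc] at h'
    have := isLittleO_irrefl (f'' := fun t : ℝ => t ^ n) (l := 𝓝[>] (0 : ℝ)) (by
      apply Eventually.frequently
      filter_upwards [self_mem_nhdsWithin] with t ht
      exact (pow_ne_zero _ (ne_of_gt (Set.mem_Ioi.1 ht))))
    exact this h'

namespace HasSeriesExpansion

variable {f g : ℝ → ℝ} {P Q : PowerSeries ℝ}

theorem congr' (h : HasSeriesExpansion f P) (hfg : f =ᶠ[𝓝[>] 0] g) : HasSeriesExpansion g P :=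
  fun N => (h N).congr' (by filter_upwards [hfg] with t ht; rw [ht]) .rfl

theorem sub (hf : HasSeriesExpansion f P) (hg : HasSeriesExpansion g Q) :
    HasSeriesExpansion (fun t => f t - g t) (P - Q) := fun N =>
  ((hf N).sub (hg N)).congr_left fun t => by
    simp only [PowerSeries.trunc_sub, Polynomial.eval_sub]; ring

theorem add (hf : HasSeriesExpansion f P) (hg : HasSeriesExpansion g Q) :
    HasSeriesExpansion (fun t => f t + g t) (P + Q) := fun N =>
  ((hf N).add (hg N)).congr_left fun t => by
    simp only [map_add, Polynomial.eval_add]; ring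

theorem of_polynomial (p : Polynomial ℝ) : HasSeriesExpansion (fun t => p.eval t) p := fun N => by
  have h : Polynomial.X ^ N ∣ p - (p : PowerSeries ℝ).trunc N := by
    rw [Polynomial.X_pow_dvd_iff]
    intro d hd
    simp [PowerSeries.coeff_trunc, hd]
  exact (isBigO_eval_of_X_pow_dvd h).congr_left fun t => by simp

theorem const (c : ℝ) : HasSeriesExpansion (fun _ => c) (PowerSeries.C c) := by
  simpa using of_polynomial (Polynomial.C c)

theorem isBigO_one (hf : HasSeriesExpansion f P) :
    f =O[𝓝[>] (0 : ℝ)] fun _ => (1 : ℝ) := by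
  simpa using hf 0

theorem mul (hf : HasSeriesExpansion f P) (hg : HasSeriesExpansion g Q) :
    HasSeriesExpansion (fun t => f t * g t) (P * Q) := fun N => by
  have h1 : (fun t : ℝ => f t * (g t - (Q.trunc N).eval t)) =O[𝓝[>] (0 : ℝ)] fun t : ℝ => t ^ N := by
    simpa using hf.isBigO_one.mul (hg N)
  have hq : (fun t : ℝ => (Q.trunc N).eval t) =O[𝓝[>] (0 : ℝ)] fun _ => (1 : ℝ) :=
    ((Q.trunc N).continuous.continuousAt.isBigO_one ℝ).mono nhdsWithin_le_nhds
  have h2 : (fun t : ℝ => (f t - (P.trunc N).eval t) * (Q.trunc N).eval t)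
      =O[𝓝[>] (0 : ℝ)] fun t : ℝ => t ^ N := by
    simpa using (hf N).mul hq
  have h3 : Polynomial.X ^ N ∣ P.trunc N * Q.trunc N - (P * Q).trunc N := by
    rw [Polynomial.X_pow_dvd_iff]
    intro d hd
    rw [Polynomial.coeff_sub, ← PowerSeries.trunc_trunc_mul_trunc]
    simp only [PowerSeries.coeff_trunc, if_pos hd]
    rw [← Polynomial.coe_mul, Polynomial.coeff_coe, sub_self]
  refine ((h1.add h2).add (isBigO_eval_of_X_pow_dvd h3)).congr_left fun t => ?_
  simp only [Polynomial.eval_sub, Polynomial.eval_mul]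
  ring

theorem pow (hf : HasSeriesExpansion f P) (k : ℕ) :
    HasSeriesExpansion (fun t => f t ^ k) (P ^ k) := by
  induction k with
  | zero => simpa using const 1
  | succ k ih => simpa only [pow_succ] using ih.mul hf

theorem sum {ι : Type*} (s : Finset ι) {f : ι → ℝ → ℝ} {P : ι → PowerSeries ℝ}
    (h : ∀ i ∈ s, HasSeriesExpansion (f i) (P i)) :
    HasSeriesExpansion (fun t => ∑ i ∈ s, f i t) (∑ i ∈ s, P i) := by
  classical
  induction s using Finset.induction_on with
  | empty => simpa using const 0
  | insert i s his ih =>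
    simp only [Finset.sum_insert his]
    exact (h i (by simp)).add (ih fun j hj => h j (by simp [hj]))

/-- Convergence at `r` bounds the terms there, so for `t < r / 2` the tail from degree `N` is at
most a geometric series of ratio `1/2`. -/
theorem of_hasSum {r : ℝ} (hr : 0 < r)
    (h : ∀ t, 0 < t → t ≤ r → HasSum (fun n => P.coeff n * t ^ n) (f t)) :
    HasSeriesExpansion f P := fun N => by
  obtain ⟨M, hM⟩ := (h r hr le_rfl).summable.tendsto_atTop_zero.norm.bddAbove_range
  have hs : ∀ n, ‖P.coeff n * r ^ n‖ ≤ M := fun n => hM ⟨n, rfl⟩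
  have hM0 : 0 ≤ M := (norm_nonneg _).trans (hs 0)
  refine IsBigO.of_bound (M / r ^ N * 2) ?_
  filter_upwards [Ioo_mem_nhdsGT (show (0 : ℝ) < r / 2 by positivity)] with t ht
  have ht0 := ht.1
  have hs1 := h t ht0 (by linarith [ht.2])
  have hs2 : HasSum (fun n => P.coeff (n + N) * t ^ (n + N)) (f t - (P.trunc N).eval t) := by
    rw [eval_trunc_eq_sum]
    exact (hasSum_nat_add_iff' N).2 hs1
  have hg : HasSum (fun n : ℕ => (M / r ^ N * t ^ N) * (1 / 2 : ℝ) ^ n)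
      ((M / r ^ N * t ^ N) * 2) := hasSum_geometric_two.mul_left _
  rw [← hs2.tsum_eq, Real.norm_of_nonneg (pow_nonneg ht0.le N)]
  refine (tsum_of_norm_bounded hg fun n => ?_).trans (le_of_eq (by ring))
  have h1 := hs (n + N)
  rw [norm_mul, Real.norm_of_nonneg (by positivity : 0 ≤ r ^ (n + N))] at h1
  rw [norm_mul, Real.norm_of_nonneg (by positivity : 0 ≤ t ^ (n + N))]
  have h2 : ‖P.coeff (n + N)‖ ≤ M / r ^ (n + N) := (le_div_iff₀ (by positivity)).2 h1
  calc _ ≤ M / r ^ (n + N) * t ^ (n + N) := by gcongr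
    _ = M / r ^ N * t ^ N * (t / r) ^ n := by rw [pow_add, pow_add, div_pow]; field_simp
    _ ≤ _ := by
      have : t / r ≤ 1 / 2 := by rw [div_le_iff₀ hr]; linarith [ht.2]
      gcongr

end HasSeriesExpansion

/-- The formal composition `∑ c_k W^k` of power series, for `W` without constant term. -/
noncomputable def formalComp (c W : PowerSeries ℝ) : PowerSeries ℝ :=
  PowerSeries.mk fun n => ∑ k ∈ Finset.range (n + 1), c.coeff k * (W ^ k).coeff n

theorem HasSeriesExpansion.comp {F w : ℝ → ℝ} {c W : PowerSeries ℝ}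
    (hF : HasSeriesExpansion F c) (hw : HasSeriesExpansion w W) (hW : W.constantCoeff = 0)
    (hpos : ∀ᶠ t in 𝓝[>] (0 : ℝ), 0 < w t) :
    HasSeriesExpansion (fun t => F (w t)) (formalComp c W) := fun N => by
  have hw1 : w =O[𝓝[>] (0 : ℝ)] fun t => t := by
    have := hw 1
    simpa [PowerSeries.trunc_one_left, hW] using this
  have hlim : Tendsto w (𝓝[>] 0) (𝓝[>] 0) := by
    refine tendsto_nhdsWithin_iff.2 ⟨?_, hpos⟩
    exact hw1.trans_tendsto (tendsto_id.mono_left nhdsWithin_le_nhds)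
  have h1 : (fun t => F (w t) - (c.trunc N).eval (w t)) =O[𝓝[>] (0 : ℝ)] fun t => t ^ N :=
    ((hF N).comp_tendsto hlim).trans (hw1.pow N)
  have h2 : HasSeriesExpansion (fun t => (c.trunc N).eval (w t))
      (∑ k ∈ Finset.range N, PowerSeries.C (c.coeff k) * W ^ k) := by
    simp only [eval_trunc_eq_sum]
    exact HasSeriesExpansion.sum _ fun k _ => (HasSeriesExpansion.const _).mul (hw.pow k)
  have h3 : (∑ k ∈ Finset.range N, PowerSeries.C (c.coeff k) * W ^ k).trunc N =
      (formalComp c W).trunc N := by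
    ext n
    simp only [PowerSeries.coeff_trunc]
    split_ifs with hn
    · rw [formalComp, PowerSeries.coeff_mk, map_sum]
      simp only [PowerSeries.coeff_C_mul]
      -- Powers `W^k` with `k > n` have order above `n`, so the finite sum defining `formalComp`
      -- loses nothing.
      refine (Finset.sum_subset (Finset.range_mono hn) fun k _ hk => ?_).symm
      rw [PowerSeries.coeff_of_lt_order n, mul_zero]
      have h4 : (1 : ℕ∞) ≤ W.order := PowerSeries.one_le_order_iff_constCoeff_eq_zero.2 hW
      have h5 : (k : ℕ∞) ≤ (W ^ k).order := by
        calc (k : ℕ∞) = k • 1 := by simp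
          _ ≤ k • W.order := by gcongr
          _ ≤ _ := PowerSeries.le_order_pow _ _
      refine lt_of_lt_of_le ?_ h5
      simp only [Finset.mem_range, not_lt] at hk
      exact_mod_cast hk
    · rfl
  have h4 := h2 N
  rw [h3] at h4
  exact (h1.add h4).congr_left fun t => by ring

/-! ### Coefficients of powers of `(1 + t) / (1 - t)`. -/

/-- The power series of `(1 + t) / (1 - t)`. -/
noncomputable def cayleySeries : PowerSeries ℝ := PowerSeries.mk fun n => if n = 0 then 1 else 2

theorem cayleySeries_eq :
    cayleySeries = (1 + PowerSeries.X) * PowerSeries.mk (fun _ => (1 : ℝ)) := by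
  ext n
  cases n with
  | zero => simp [cayleySeries]
  | succ n =>
    rw [add_mul, one_mul, map_add, PowerSeries.coeff_succ_X_mul]
    simp [cayleySeries]; norm_num

theorem derivative_cayleySeries :
    PowerSeries.derivative ℝ cayleySeries =
      2 * (PowerSeries.mk (fun _ => (1 : ℝ)) * PowerSeries.mk (fun _ => (1 : ℝ))) := by
  ext n
  rw [PowerSeries.coeff_derivative, two_mul, map_add, PowerSeries.coeff_mul]
  simp [cayleySeries]
  ring

theorem hasSeriesExpansion_cayley :
    HasSeriesExpansion (fun t => (1 + t) / (1 - t)) cayleySeries := by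
  refine HasSeriesExpansion.of_hasSum (r := 1 / 2) (by norm_num) fun t ht0 ht1 => ?_
  have h1 : HasSum (fun n : ℕ => 2 * t ^ n) (2 * (1 - t)⁻¹) :=
    (hasSum_geometric_of_lt_one ht0.le (by linarith)).mul_left 2
  have h2 := h1.sub (hasSum_ite_eq (0 : ℕ) (1 : ℝ))
  have h3 : 1 - t ≠ 0 := by linarith
  have h4 : (1 + t) / (1 - t) = 2 * (1 - t)⁻¹ - 1 := by field_simp; ring
  rw [h4]
  refine h2.congr_fun fun n => ?_
  rcases eq_or_ne n 0 with rfl | hn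
  · norm_num [cayleySeries]
  · simp [cayleySeries, hn]

theorem coeff_mul_nonneg {P Q : PowerSeries ℝ} (hP : ∀ n, 0 ≤ P.coeff n)
    (hQ : ∀ n, 0 ≤ Q.coeff n) (n : ℕ) : 0 ≤ (P * Q).coeff n := by
  rw [PowerSeries.coeff_mul]
  exact Finset.sum_nonneg fun i _ => mul_nonneg (hP _) (hQ _)

theorem coeff_pow_nonneg {P : PowerSeries ℝ} (hP : ∀ n, 0 ≤ P.coeff n) (k n : ℕ) :
    0 ≤ (P ^ k).coeff n := by
  induction k generalizing n with
  | zero => rw [pow_zero, PowerSeries.coeff_one]; split_ifs <;> norm_num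
  | succ k ih => rw [pow_succ]; exact coeff_mul_nonneg ih hP n

/-- Multiplication by a series with nonnegative coefficients preserves domination. -/
theorem abs_coeff_mul_le {H J K : PowerSeries ℝ} {c : ℝ} (hH : ∀ n, 0 ≤ H.coeff n)
    (h : ∀ n, |J.coeff n| ≤ c * K.coeff n) (n : ℕ) :
    |(H * J).coeff n| ≤ c * (H * K).coeff n := by
  rw [PowerSeries.coeff_mul, PowerSeries.coeff_mul, Finset.mul_sum]
  refine (Finset.abs_sum_le_sum_abs _ _).trans (Finset.sum_le_sum fun i _ => ?_)
  rw [abs_mul, abs_of_nonneg (hH _)]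
  calc _ ≤ H.coeff i.1 * (c * K.coeff i.2) := mul_le_mul_of_nonneg_left (h _) (hH _)
    _ = _ := by ring

theorem coeff_le_coeff_mul {P Q : PowerSeries ℝ} (hP : ∀ n, 0 ≤ P.coeff n)
    (hP0 : 1 ≤ P.coeff 0) (hQ : ∀ n, 0 ≤ Q.coeff n) (n : ℕ) : Q.coeff n ≤ (P * Q).coeff n := by
  rw [PowerSeries.coeff_mul]
  calc Q.coeff n ≤ P.coeff 0 * Q.coeff n := le_mul_of_one_le_left (hQ n) hP0
    _ ≤ _ := Finset.single_le_sum (f := fun p : ℕ × ℕ => P.coeff p.1 * Q.coeff p.2)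
      (fun i _ => mul_nonneg (hP _) (hQ _)) (by simp : ((0, n) : ℕ × ℕ) ∈ _)

theorem coeff_cayleySeries_nonneg (n : ℕ) : 0 ≤ cayleySeries.coeff n := by
  rw [cayleySeries, PowerSeries.coeff_mk]; split_ifs <;> norm_num

theorem coeff_cayleySeries_pow_nonneg (k n : ℕ) : 0 ≤ (cayleySeries ^ k).coeff n :=
  coeff_pow_nonneg coeff_cayleySeries_nonneg k n

theorem one_le_coeff_zero_cayleySeries_pow (k : ℕ) : 1 ≤ (cayleySeries ^ k).coeff 0 := by
  rw [PowerSeries.coeff_zero_eq_constantCoeff, map_pow]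
  simp [cayleySeries, ← PowerSeries.coeff_zero_eq_constantCoeff_apply]

theorem coeff_cayleySeries_pow_mono {k l : ℕ} (h : k ≤ l) (n : ℕ) :
    (cayleySeries ^ k).coeff n ≤ (cayleySeries ^ l).coeff n := by
  obtain ⟨m, rfl⟩ := Nat.exists_eq_add_of_le' h
  rw [pow_add]
  exact coeff_le_coeff_mul (coeff_cayleySeries_pow_nonneg m)
    (one_le_coeff_zero_cayleySeries_pow m) (coeff_cayleySeries_pow_nonneg k) n

/-- Each new factor costs at most `4^n`: `n + 1 ≤ 2^n` terms in the convolution, and coefficients at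
most `2^j`. -/
theorem coeff_cayleySeries_pow_le (k n : ℕ) : (cayleySeries ^ k).coeff n ≤ (4 ^ k) ^ n := by
  induction k generalizing n with
  | zero =>
    rw [pow_zero, PowerSeries.coeff_one]; split_ifs <;> norm_num
  | succ k ih =>
    rw [pow_succ, PowerSeries.coeff_mul]
    have h : ∀ p ∈ Finset.HasAntidiagonal.antidiagonal n, (cayleySeries ^ k).coeff p.1 * cayleySeries.coeff p.2
        ≤ (4 ^ k * 2) ^ n := fun p hp => by
      have h2 : cayleySeries.coeff p.2 ≤ 2 ^ p.2 := by
        rw [cayleySeries, PowerSeries.coeff_mk]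
        split_ifs with h0
        · exact one_le_pow₀ (by norm_num)
        · exact le_self_pow₀ (by norm_num) h0
      have h4 : (1 : ℝ) ≤ 4 ^ k := one_le_pow₀ (by norm_num)
      rw [← Finset.HasAntidiagonal.mem_antidiagonal.1 hp]
      calc _ ≤ ((4 : ℝ) ^ k) ^ p.1 * 2 ^ p.2 :=
            mul_le_mul (ih _) h2 (coeff_cayleySeries_nonneg _) (by positivity)
        _ ≤ (4 ^ k * 2) ^ p.1 * (4 ^ k * 2) ^ p.2 := by
            gcongr
            · linarith
            · linarith
        _ = _ := by rw [pow_add]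
    refine (Finset.sum_le_card_nsmul _ _ _ h).trans ?_
    rw [Finset.Nat.card_antidiagonal, nsmul_eq_mul]
    have : ((n + 1 : ℕ) : ℝ) ≤ 2 ^ n := by exact_mod_cast Nat.lt_two_pow_self
    calc _ ≤ (2 : ℝ) ^ n * (4 ^ k * 2) ^ n := by gcongr
      _ = _ := by rw [← mul_pow]; ring

/-- With `I = 1 / (1 - X)`, differentiation gives `(1 + X) (C^k)' = 2k I C^k` for `C = (1 + X) I`.
In degree `n` the left side contains `n` times the coefficient of `C^k` plus a nonnegative term, and
`I ≤ C` coefficientwise. -/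
theorem natCast_mul_coeff_cayleySeries_pow_le (k n : ℕ) :
    n * (cayleySeries ^ k).coeff n ≤ 2 * k * (cayleySeries ^ (k + 1)).coeff n := by
  set I : PowerSeries ℝ := PowerSeries.mk (fun _ => (1 : ℝ)) with hI
  have hd : (1 + PowerSeries.X) * PowerSeries.derivative ℝ (cayleySeries ^ k) =
      PowerSeries.C (2 * k : ℝ) * (I * cayleySeries ^ k) := by
    cases k with
    | zero => simp
    | succ k =>
      rw [PowerSeries.derivative_pow, derivative_cayleySeries, ← hI]
      have : cayleySeries = (1 + PowerSeries.X) * I := cayleySeries_eq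
      simp only [Nat.add_sub_cancel, pow_succ, map_mul, map_natCast, map_ofNat]
      rw [this]; ring
  have hc := congrArg (PowerSeries.coeff n) hd
  rw [PowerSeries.coeff_C_mul, add_mul, one_mul, map_add, PowerSeries.coeff_derivative] at hc
  have hx : n * (cayleySeries ^ k).coeff n =
      (PowerSeries.X * PowerSeries.derivative ℝ (cayleySeries ^ k)).coeff n := by
    cases n with
    | zero => simp
    | succ n =>
      rw [PowerSeries.coeff_succ_X_mul, PowerSeries.coeff_derivative]; push_cast; ring
  have hle : (I * cayleySeries ^ k).coeff n ≤ (cayleySeries ^ (k + 1)).coeff n := by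
    rw [pow_succ', PowerSeries.coeff_mul, PowerSeries.coeff_mul]
    refine Finset.sum_le_sum fun p _ =>
      mul_le_mul_of_nonneg_right ?_ (coeff_cayleySeries_pow_nonneg _ _)
    simp only [hI, cayleySeries, PowerSeries.coeff_mk]
    split_ifs <;> norm_num
  have h1 : 0 ≤ (cayleySeries ^ k).coeff (n + 1) * ((n : ℝ) + 1) :=
    mul_nonneg (coeff_cayleySeries_pow_nonneg _ _) (by positivity)
  have h2 : (2 * k : ℝ) * (I * cayleySeries ^ k).coeff n ≤
    2 * k * (cayleySeries ^ (k + 1)).coeff n := mul_le_mul_of_nonneg_left hle (by positivity)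
  linarith

/-! ### The series of `sec √x` and a lower bound for its coefficients. -/

/-- The power series of `cos √x`. -/
noncomputable def cosSqrtSeries : PowerSeries ℝ :=
  PowerSeries.mk fun k => (-1) ^ k / ((2 * k)! : ℝ)

/-- The power series of `sin √x / √x`. -/
noncomputable def sincSqrtSeries : PowerSeries ℝ :=
  PowerSeries.mk fun k => (-1) ^ k / ((2 * k + 1)! : ℝ)

/-- The power series of `sec √x`. -/
noncomputable def secSqrtSeries : PowerSeries ℝ := cosSqrtSeries⁻¹

theorem coeff_X_mul_derivative (P : PowerSeries ℝ) (n : ℕ) :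
    (PowerSeries.X * PowerSeries.derivative ℝ P).coeff n = n * P.coeff n := by
  cases n with
  | zero => simp
  | succ n => rw [PowerSeries.coeff_succ_X_mul, PowerSeries.coeff_derivative]; push_cast; ring

theorem two_mul_derivative_cosSqrtSeries :
    2 * PowerSeries.derivative ℝ cosSqrtSeries = -sincSqrtSeries := by
  ext k
  rw [two_mul, map_add, PowerSeries.coeff_derivative, map_neg, cosSqrtSeries, sincSqrtSeries,
    PowerSeries.coeff_mk, PowerSeries.coeff_mk, show 2 * (k + 1) = 2 * k + 1 + 1 by ring,
    Nat.factorial_succ (2 * k + 1)]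
  have : ((2 * k + 1)! : ℝ) ≠ 0 := by positivity
  push_cast
  field_simp
  ring

theorem two_mul_X_mul_derivative_sincSqrtSeries :
    2 * (PowerSeries.X * PowerSeries.derivative ℝ sincSqrtSeries) + sincSqrtSeries =
      cosSqrtSeries := by
  ext k
  rw [two_mul, map_add, map_add, coeff_X_mul_derivative, cosSqrtSeries, sincSqrtSeries,
    PowerSeries.coeff_mk, PowerSeries.coeff_mk, Nat.factorial_succ (2 * k)]
  have : ((2 * k)! : ℝ) ≠ 0 := by positivity
  push_cast
  field_simp
  ring

theorem constantCoeff_cosSqrtSeries : cosSqrtSeries.constantCoeff = 1 := by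
  simp [cosSqrtSeries, ← PowerSeries.coeff_zero_eq_constantCoeff_apply]

theorem cosSqrtSeries_sq_add :
    cosSqrtSeries * cosSqrtSeries + PowerSeries.X * (sincSqrtSeries * sincSqrtSeries) = 1 := by
  apply PowerSeries.derivative.ext
  · simp only [map_add, Derivation.leibniz, smul_eq_mul, PowerSeries.derivative_X,
      PowerSeries.derivative_one]
    linear_combination cosSqrtSeries * two_mul_derivative_cosSqrtSeries +
      sincSqrtSeries * two_mul_X_mul_derivative_sincSqrtSeries
  · simp [constantCoeff_cosSqrtSeries]

theorem cosSqrtSeries_mul_sec : cosSqrtSeries * secSqrtSeries = 1 :=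
  PowerSeries.mul_inv_cancel _ (by rw [constantCoeff_cosSqrtSeries]; exact one_ne_zero)

theorem two_mul_derivative_secSqrtSeries :
    2 * PowerSeries.derivative ℝ secSqrtSeries =
      secSqrtSeries * (sincSqrtSeries * secSqrtSeries) := by
  rw [secSqrtSeries, PowerSeries.derivative_inv']
  linear_combination -cosSqrtSeries⁻¹ ^ 2 * two_mul_derivative_cosSqrtSeries

theorem two_mul_X_mul_derivative_sinc_mul_sec :
    2 * (PowerSeries.X * PowerSeries.derivative ℝ (sincSqrtSeries * secSqrtSeries)) +
      sincSqrtSeries * secSqrtSeries = secSqrtSeries * secSqrtSeries := by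
  rw [Derivation.leibniz, smul_eq_mul, smul_eq_mul]
  linear_combination secSqrtSeries * two_mul_X_mul_derivative_sincSqrtSeries +
    PowerSeries.X * sincSqrtSeries * two_mul_derivative_secSqrtSeries +
    secSqrtSeries ^ 2 * cosSqrtSeries_sq_add -
    (cosSqrtSeries * secSqrtSeries) * cosSqrtSeries_mul_sec

/-- For `s = sec √x` and `τ = tan √x / √x`, the equations `2s' = sτ` and `2xτ' + τ = s²` are
recurrences with nonnegative terms. The bound propagates along them together with `τ_i ≥ (1/2)
(1/4)^i`. -/
theorem coeff_secSqrtSeries_ge (k : ℕ) : (1 / 4 : ℝ) ^ k ≤ secSqrtSeries.coeff k := by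
  induction k using Nat.strong_induction_on with
  | _ k ih =>
    cases k with
    | zero =>
      rw [PowerSeries.coeff_zero_eq_constantCoeff_apply, secSqrtSeries,
        PowerSeries.constantCoeff_inv, constantCoeff_cosSqrtSeries]
      norm_num
    | succ k =>
      have hτ : ∀ i ≤ k, 1 / 2 * (1 / 4 : ℝ) ^ i ≤ (sincSqrtSeries * secSqrtSeries).coeff i := by
        intro i hi
        have h := congrArg (PowerSeries.coeff i) two_mul_X_mul_derivative_sinc_mul_sec
        rw [two_mul, map_add, map_add, coeff_X_mul_derivative, PowerSeries.coeff_mul i secSqrtSeries] at h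
        have h1 : ((i + 1 : ℕ) : ℝ) * (1 / 4 : ℝ) ^ i ≤ ∑ p ∈ Finset.HasAntidiagonal.antidiagonal i,
            secSqrtSeries.coeff p.1 * secSqrtSeries.coeff p.2 := by
          rw [← Finset.Nat.card_antidiagonal i, ← nsmul_eq_mul]
          refine Finset.card_nsmul_le_sum _ _ _ fun p hp => ?_
          have hp' := Finset.HasAntidiagonal.mem_antidiagonal.1 hp
          rw [← hp', pow_add]
          exact mul_le_mul (ih _ (by omega)) (ih _ (by omega)) (by positivity)
            ((by positivity : (0 : ℝ) ≤ (1 / 4) ^ p.1).trans (ih _ (by omega)))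
        rw [← h] at h1
        push_cast at h1
        have h2 : (0 : ℝ) ≤ (1 / 4) ^ i := by positivity
        have h3 : (2 * i + 1 : ℝ) * (1 / 2 * (1 / 4 : ℝ) ^ i) ≤
            (2 * i + 1) * (sincSqrtSeries * secSqrtSeries).coeff i := by linarith
        exact le_of_mul_le_mul_left h3 (by positivity)
      have h := congrArg (PowerSeries.coeff k) two_mul_derivative_secSqrtSeries
      rw [two_mul, map_add, PowerSeries.coeff_derivative, PowerSeries.coeff_mul] at h
      have h1 : ((k + 1 : ℕ) : ℝ) * (1 / 2 * (1 / 4 : ℝ) ^ k) ≤ ∑ p ∈ Finset.HasAntidiagonal.antidiagonal k,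
          secSqrtSeries.coeff p.1 * (sincSqrtSeries * secSqrtSeries).coeff p.2 := by
        rw [← Finset.Nat.card_antidiagonal k, ← nsmul_eq_mul]
        refine Finset.card_nsmul_le_sum _ _ _ fun p hp => ?_
        have hp' := Finset.HasAntidiagonal.mem_antidiagonal.1 hp
        calc 1 / 2 * (1 / 4 : ℝ) ^ k = (1 / 4) ^ p.1 * (1 / 2 * (1 / 4) ^ p.2) := by
              rw [← hp', pow_add]; ring
          _ ≤ _ := mul_le_mul (ih _ (by omega)) (hτ _ (by omega)) (by positivity)
            ((by positivity : (0 : ℝ) ≤ (1 / 4) ^ p.1).trans (ih _ (by omega)))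
      rw [← h] at h1
      push_cast at h1
      have h3 : (2 * (k + 1) : ℝ) * (1 / 4 : ℝ) ^ (k + 1) ≤
          (2 * (k + 1)) * secSqrtSeries.coeff (k + 1) := by rw [pow_succ]; linarith
      exact le_of_mul_le_mul_left h3 (by positivity)

/-- This is `sech * cosh = 1` read off in degree `2l`. -/
theorem sum_neg_one_pow_mul_coeff_secSqrtSeries (l : ℕ) :
    ∑ k ∈ Finset.range (l + 1), (-1) ^ k * secSqrtSeries.coeff k / ((2 * (l - k))! : ℝ) =
      if l = 0 then 1 else 0 := by
  have h := congrArg (PowerSeries.coeff l) cosSqrtSeries_mul_sec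
  rw [mul_comm, PowerSeries.coeff_mul, PowerSeries.coeff_one,
    Finset.Nat.sum_antidiagonal_eq_sum_range_succ
      (f := fun i j => secSqrtSeries.coeff i * cosSqrtSeries.coeff j)] at h
  have h2 : (if l = 0 then (1 : ℝ) else 0) = (-1) ^ l * if l = 0 then (1 : ℝ) else 0 := by
    split_ifs with h0 <;> simp [h0]
  rw [h2, ← h, Finset.mul_sum]
  refine Finset.sum_congr rfl fun k hk => ?_
  have hkl : k ≤ l := Nat.lt_succ_iff.1 (Finset.mem_range.1 hk)
  obtain ⟨j, rfl⟩ := Nat.exists_eq_add_of_le hkl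
  simp only [cosSqrtSeries, PowerSeries.coeff_mk, Nat.add_sub_cancel_left, pow_add]
  have : ((-1 : ℝ) ^ j) * (-1) ^ j = 1 := by rw [← mul_pow]; simp
  linear_combination -(-1) ^ k * secSqrtSeries.coeff k / ((2 * j)! : ℝ) * this

/-! ### Gaussian derivatives and Taylor remainders. -/

/-- The `k`-th derivative of `exp (-y² / 2)`. -/
noncomputable def gaussDeriv (k : ℕ) (y : ℝ) : ℝ :=
  iteratedDeriv k (fun y : ℝ => Real.exp (-(y ^ 2 / 2))) y

theorem gaussDeriv_zero (y : ℝ) : gaussDeriv 0 y = Real.exp (-(y ^ 2 / 2)) := rfl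

theorem hasDerivAt_gaussDeriv (k : ℕ) (y : ℝ) :
    HasDerivAt (gaussDeriv k) (gaussDeriv (k + 1) y) y := by
  have h : ContDiff ℝ (k + 1) (fun y : ℝ => Real.exp (-(y ^ 2 / 2))) := by fun_prop
  have h1 := ((h.differentiable_iteratedDeriv' k) y).hasDerivAt
  rw [← iteratedDeriv_succ] at h1
  exact h1

theorem gaussDeriv_neg (k : ℕ) (y : ℝ) : gaussDeriv k (-y) = (-1) ^ k * gaussDeriv k y := by
  have h := iteratedDeriv_comp_neg k (fun y : ℝ => Real.exp (-(y ^ 2 / 2))) (-y)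
  simpa [gaussDeriv] using h

theorem gaussDeriv_eq (k : ℕ) (y : ℝ) : gaussDeriv k y =
    (-1 : ℝ) ^ k * Polynomial.aeval y (Polynomial.hermite k) * Real.exp (-(y ^ 2 / 2)) := by
  rw [gaussDeriv, iteratedDeriv_eq_iterate, Polynomial.deriv_gaussian_eq_hermite_mul_gaussian]

theorem gaussDeriv_two_mul_zero (k : ℕ) :
    gaussDeriv (2 * k) 0 = (-1) ^ k * ((2 * k - 1)‼ : ℝ) := by
  have h := Polynomial.coeff_hermite_explicit k 0
  rw [gaussDeriv_eq, Polynomial.aeval_def, ← Polynomial.eval_map, ← Polynomial.coeff_zero_eq_eval_zero,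
    Polynomial.coeff_map]
  rw [add_zero] at h
  rw [h]
  simp

theorem exists_abs_eval_mul_exp_le (p : Polynomial ℝ) :
    ∃ C : ℝ, ∀ y : ℝ, |p.eval y| * Real.exp (-(y ^ 2 / 2)) ≤ C := by
  induction p using Polynomial.induction_on' with
  | add p q hp hq =>
    obtain ⟨C, hC⟩ := hp
    obtain ⟨D, hD⟩ := hq
    refine ⟨C + D, fun y => ?_⟩
    rw [Polynomial.eval_add]
    have := mul_le_mul_of_nonneg_right (abs_add_le (p.eval y) (q.eval y))
      (Real.exp_pos (-(y ^ 2 / 2))).le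
    linarith [hC y, hD y]
  | monomial n a =>
    refine ⟨|a| * (1 + 2 ^ n * n !), fun y => ?_⟩
    rw [Polynomial.eval_monomial, abs_mul, mul_assoc]
    gcongr
    rw [Real.exp_neg, ← div_eq_mul_inv, div_le_iff₀ (Real.exp_pos _)]
    have h1 := Real.pow_div_factorial_le_exp (y ^ 2 / 2) (by positivity) n
    have h2 : (1 : ℝ) ≤ Real.exp (y ^ 2 / 2) := Real.one_le_exp (by positivity)
    rw [div_le_iff₀ (by positivity), div_pow, div_le_iff₀ (by positivity), ← pow_mul, mul_comm 2 n,
      pow_mul] at h1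
    have h3 : |y ^ n| ≤ 1 + (y ^ n) ^ 2 := by nlinarith [sq_nonneg (|y ^ n| - 1), sq_abs (y ^ n), abs_nonneg (y ^ n)]
    nlinarith

/-- Decay like `1 / y²` is all that summation over the sample points requires. -/
theorem exists_abs_gaussDeriv_le (k : ℕ) :
    ∃ C : ℝ, 0 ≤ C ∧ ∀ y : ℝ, |gaussDeriv k y| ≤ C / (1 + y ^ 2) := by
  obtain ⟨C, hC⟩ := exists_abs_eval_mul_exp_le
    ((Polynomial.hermite k).map (Int.castRingHom ℝ) * (1 + Polynomial.X ^ 2))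
  refine ⟨C, (by positivity : (0 : ℝ) ≤ _).trans (hC 0), fun y => ?_⟩
  rw [le_div_iff₀ (by positivity)]
  refine le_trans (le_of_eq ?_) (hC y)
  rw [gaussDeriv_eq, abs_mul, abs_mul, abs_pow, abs_neg, abs_one, one_pow, one_mul,
    abs_of_pos (Real.exp_pos _), Polynomial.eval_mul, abs_mul, Polynomial.eval_map,
    Polynomial.aeval_def]
  simp only [Polynomial.eval_add, Polynomial.eval_one, Polynomial.eval_pow, Polynomial.eval_X]
  rw [abs_of_pos (by positivity : 0 < 1 + y ^ 2)]
  simp only [algebraMap_int_eq]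
  ring

/-- The derivative of the remainder of order `N + 1` for `g m` is the remainder of order `N` for `g
(m + 1)`, so the mean value inequality gives an induction. The factor `1 / N!` is given up. -/
theorem abs_taylor_remainder_le {g : ℕ → ℝ → ℝ} (hg : ∀ k y, HasDerivAt (g k) (g (k + 1) y) y)
    (y r B : ℝ) (N m : ℕ) (hB : ∀ s, |s| ≤ r → |g (m + N) (y + s)| ≤ B) (s : ℝ) (hs : |s| ≤ r) :
    |g m (y + s) - ∑ j ∈ Finset.range N, s ^ j / (j ! : ℝ) * g (m + j) y| ≤ B * r ^ N := by
  induction N generalizing m s with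
  | zero => simpa using hB s hs
  | succ N ih =>
    have hr : 0 ≤ r := (abs_nonneg s).trans hs
    have ih' := ih (m + 1) (by rwa [show m + 1 + N = m + (N + 1) by ring])
    have hd : ∀ z ∈ Set.Icc (-r) r, HasDerivWithinAt
        (fun z => g m (y + z) - ∑ j ∈ Finset.range (N + 1), z ^ j / (j ! : ℝ) * g (m + j) y)
        (g (m + 1) (y + z) - ∑ j ∈ Finset.range N, z ^ j / (j ! : ℝ) * g (m + 1 + j) y)
        (Set.Icc (-r) r) z := fun z _ => by
      have h1 : HasDerivAt (fun z => g m (y + z)) (g (m + 1) (y + z)) z :=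
        (hg m (y + z)).comp_const_add y z
      have h2 : HasDerivAt
          (fun z => ∑ j ∈ Finset.range (N + 1), z ^ j / (j ! : ℝ) * g (m + j) y)
          (∑ j ∈ Finset.range N, z ^ j / (j ! : ℝ) * g (m + 1 + j) y) z := by
        simp only [Finset.sum_range_succ']
        have h3 : ∀ j ∈ Finset.range N, HasDerivAt
            (fun z : ℝ => z ^ (j + 1) / ((j + 1)! : ℝ) * g (m + (j + 1)) y)
            (z ^ j / (j ! : ℝ) * g (m + 1 + j) y) z := fun j _ => by
          have := ((hasDerivAt_pow (j + 1) z).div_const ((j + 1)! : ℝ)).mul_const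
            (g (m + (j + 1)) y)
          refine this.congr_deriv ?_
          rw [show m + (j + 1) = m + 1 + j by ring, Nat.factorial_succ]
          have : (j ! : ℝ) ≠ 0 := by positivity
          push_cast
          field_simp
        simpa using (HasDerivAt.fun_sum h3).add_const (g m y)
      exact (h1.sub h2).hasDerivWithinAt
    have h := (convex_Icc (-r) r).norm_image_sub_le_of_norm_hasDerivWithin_le (C := B * r ^ N) hd
      (fun z hz => ih' z (abs_le.2 hz)) (x := 0) (y := s) (by simp [hr]) (abs_le.1 hs)
    rw [Finset.sum_range_succ' _ N] at h
    simp only [Real.norm_eq_abs] at h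
    have hBr : 0 ≤ B * r ^ N := (abs_nonneg _).trans (ih' s hs)
    calc _ ≤ B * r ^ N * |s| := by simpa [Finset.sum_range_succ'] using h
      _ ≤ B * r ^ N * r := by gcongr
      _ = _ := by ring

theorem abs_symm_taylor_remainder_le {g : ℕ → ℝ → ℝ}
    (hg : ∀ k y, HasDerivAt (g k) (g (k + 1) y) y) (y δ B : ℝ) (hδ : 0 ≤ δ) (K m : ℕ)
    (hB : ∀ s, |s| ≤ δ → |g (m + 2 * K) (y + s)| ≤ B) :
    |g m (y + δ) + g m (y - δ) -
      2 * ∑ j ∈ Finset.range K, δ ^ (2 * j) / ((2 * j)! : ℝ) * g (m + 2 * j) y| ≤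
      2 * (B * δ ^ (2 * K)) := by
  have h1 := abs_taylor_remainder_le hg y δ B (2 * K) m hB δ (abs_of_nonneg hδ).le
  have h2 := abs_taylor_remainder_le hg y δ B (2 * K) m hB (-δ)
    (by rw [abs_neg, abs_of_nonneg hδ])
  have h3 : ∀ K, 2 * ∑ j ∈ Finset.range K, δ ^ (2 * j) / ((2 * j)! : ℝ) * g (m + 2 * j) y =
      ∑ j ∈ Finset.range (2 * K), δ ^ j / (j ! : ℝ) * g (m + j) y +
      ∑ j ∈ Finset.range (2 * K), (-δ) ^ j / (j ! : ℝ) * g (m + j) y := by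
    intro K
    induction K with
    | zero => simp
    | succ K ih =>
      rw [Finset.sum_range_succ, mul_add, ih, show 2 * (K + 1) = 2 * K + 1 + 1 by ring]
      simp only [Finset.sum_range_succ]
      rw [Even.neg_pow (even_two_mul K), Odd.neg_pow (odd_two_mul_add_one K)]
      ring
  rw [h3, sub_eq_add_neg y δ]
  calc _ = |(g m (y + δ) - ∑ j ∈ Finset.range (2 * K), δ ^ j / (j ! : ℝ) * g (m + j) y) +
        (g m (y + -δ) - ∑ j ∈ Finset.range (2 * K), (-δ) ^ j / (j ! : ℝ) * g (m + j) y)| := by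
        congr 1; ring
    _ ≤ _ := (abs_add_le _ _).trans (by linarith)

/-! ### Approximate inversion of `2 cosh (δ D)` and telescoping. -/

/-- Truncation of `(2 cosh (δ D))⁻¹` applied to the Gaussian `exp (-y² / 2)`. -/
noncomputable def gaussHalfSum (N : ℕ) (δ y : ℝ) : ℝ :=
  1 / 2 * ∑ k ∈ Finset.range N,
    (-1) ^ k * secSqrtSeries.coeff k * δ ^ (2 * k) * gaussDeriv (2 * k) y

theorem gaussHalfSum_neg (N : ℕ) (δ y : ℝ) : gaussHalfSum N δ (-y) = gaussHalfSum N δ y := by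
  simp [gaussHalfSum, gaussDeriv_neg]

theorem exists_abs_gaussHalfSum_le (N : ℕ) (δ : ℝ) :
    ∃ C : ℝ, 0 ≤ C ∧ ∀ y, |gaussHalfSum N δ y| ≤ C / (1 + y ^ 2) := by
  choose C hC0 hC using exists_abs_gaussDeriv_le
  refine ⟨1 / 2 * ∑ k ∈ Finset.range N,
    |(-1) ^ k * secSqrtSeries.coeff k * δ ^ (2 * k)| * C (2 * k),
    mul_nonneg (by norm_num) (Finset.sum_nonneg fun k _ => mul_nonneg (abs_nonneg _) (hC0 _)),
    fun y => ?_⟩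
  rw [gaussHalfSum, abs_mul, abs_of_pos (by norm_num : (0 : ℝ) < 1 / 2), mul_div_assoc,
    Finset.sum_div]
  gcongr
  refine (Finset.abs_sum_le_sum_abs _ _).trans (Finset.sum_le_sum fun k _ => ?_)
  rw [abs_mul, mul_div_assoc]
  exact mul_le_mul_of_nonneg_left (hC _ _) (abs_nonneg _)

/-- Truncating the product of sech and cosh by total order `l = k + j` leaves only `l = 0`. -/
theorem exp_eq_sum_sum_gaussDeriv (N : ℕ) (δ y : ℝ) :
    ∑ k ∈ Finset.range (N + 1), (-1) ^ k * secSqrtSeries.coeff k * δ ^ (2 * k) *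
      ∑ j ∈ Finset.range (N + 1 - k), δ ^ (2 * j) / ((2 * j)! : ℝ) * gaussDeriv (2 * k + 2 * j) y =
      Real.exp (-(y ^ 2 / 2)) := by
  simp only [Finset.mul_sum]
  rw [← Finset.sum_range_diag_flip (N + 1) fun k j => (-1) ^ k * secSqrtSeries.coeff k *
    δ ^ (2 * k) * (δ ^ (2 * j) / ((2 * j)! : ℝ) * gaussDeriv (2 * k + 2 * j) y)]
  have h : ∀ l ∈ Finset.range (N + 1), ∑ k ∈ Finset.range (l + 1), (-1) ^ k *
      secSqrtSeries.coeff k * δ ^ (2 * k) * (δ ^ (2 * (l - k)) / ((2 * (l - k))! : ℝ) *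
      gaussDeriv (2 * k + 2 * (l - k)) y) =
      (if l = 0 then 1 else 0) * (δ ^ (2 * l) * gaussDeriv (2 * l) y) := fun l _ => by
    rw [← sum_neg_one_pow_mul_coeff_secSqrtSeries, Finset.sum_mul]
    refine Finset.sum_congr rfl fun k hk => ?_
    obtain ⟨j, rfl⟩ := Nat.exists_eq_add_of_le (Nat.lt_succ_iff.1 (Finset.mem_range.1 hk))
    rw [Nat.add_sub_cancel_left, mul_add, pow_add]
    ring
  rw [Finset.sum_congr rfl h]
  simp [gaussDeriv_zero]

theorem exists_abs_gaussHalfSum_add_sub_le (N : ℕ) :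
    ∃ C : ℝ, 0 ≤ C ∧ ∀ δ, 0 < δ → δ ≤ 1 / 2 → ∀ y,
      |gaussHalfSum (N + 1) δ (y + δ) + gaussHalfSum (N + 1) δ (y - δ) -
        Real.exp (-(y ^ 2 / 2))| ≤ C * δ ^ (2 * (N + 1)) / (1 + y ^ 2) := by
  obtain ⟨C, hC0, hC⟩ := exists_abs_gaussDeriv_le (2 * (N + 1))
  refine ⟨∑ k ∈ Finset.range (N + 1), |secSqrtSeries.coeff k| * (2 * C),
    Finset.sum_nonneg fun k _ => by positivity, fun δ hδ hδ1 y => ?_⟩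
  have hB : ∀ s, |s| ≤ δ → |gaussDeriv (2 * (N + 1)) (y + s)| ≤ 2 * C / (1 + y ^ 2) := by
    intro s hs
    refine (hC _).trans ?_
    rw [div_le_div_iff₀ (by positivity) (by positivity)]
    have h1 : s ^ 2 ≤ 1 / 4 := by
      rw [← sq_abs]; nlinarith [abs_nonneg s]
    have h2 : 1 + y ^ 2 ≤ 2 * (1 + (y + s) ^ 2) := by nlinarith [sq_nonneg (y + 2 * s)]
    nlinarith
  rw [← exp_eq_sum_sum_gaussDeriv N δ y, gaussHalfSum, gaussHalfSum, ← mul_add,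
    ← Finset.sum_add_distrib, Finset.mul_sum, ← Finset.sum_sub_distrib, Finset.sum_mul,
    Finset.sum_div]
  refine (Finset.abs_sum_le_sum_abs _ _).trans (Finset.sum_le_sum fun k hk => ?_)
  have hk' : k ≤ N + 1 := (Finset.mem_range.1 hk).le
  -- The `k`-th term already carries `δ^(2k)`, so Taylor expansion to order `2(N + 1 - k)` gives
  -- every term the same error order and the same Gaussian derivative.
  have h := abs_symm_taylor_remainder_le hasDerivAt_gaussDeriv y δ (2 * C / (1 + y ^ 2)) hδ.le
    (N + 1 - k) (2 * k) (by rwa [← mul_add, Nat.add_sub_cancel' hk'])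
  calc _ = |(-1) ^ k * (1 / 2 * secSqrtSeries.coeff k * δ ^ (2 * k)) *
        (gaussDeriv (2 * k) (y + δ) + gaussDeriv (2 * k) (y - δ) -
        2 * ∑ j ∈ Finset.range (N + 1 - k), δ ^ (2 * j) / ((2 * j)! : ℝ) *
          gaussDeriv (2 * k + 2 * j) y)| := by congr 1; ring
    _ = 1 / 2 * |secSqrtSeries.coeff k| * δ ^ (2 * k) *
        |gaussDeriv (2 * k) (y + δ) + gaussDeriv (2 * k) (y - δ) -
        2 * ∑ j ∈ Finset.range (N + 1 - k), δ ^ (2 * j) / ((2 * j)! : ℝ) *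
          gaussDeriv (2 * k + 2 * j) y| := by
        rw [abs_mul, abs_mul, abs_pow, abs_neg, abs_one, one_pow, one_mul, abs_mul, abs_mul,
          abs_of_pos (by norm_num : (0 : ℝ) < 1 / 2), abs_of_pos (by positivity : 0 < δ ^ (2 * k))]
    _ ≤ 1 / 2 * |secSqrtSeries.coeff k| * δ ^ (2 * k) *
        (2 * (2 * C / (1 + y ^ 2) * δ ^ (2 * (N + 1 - k)))) := by gcongr
    _ = |secSqrtSeries.coeff k| * (2 * C) * (δ ^ (2 * k) * δ ^ (2 * (N + 1 - k))) /
        (1 + y ^ 2) := by ring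
    _ = _ := by rw [← pow_add, ← mul_add, Nat.add_sub_cancel' hk']

theorem summable_one_div_nat_succ_sq : Summable fun n : ℕ => 1 / ((n : ℝ) + 1) ^ 2 := by
  have := (summable_nat_add_iff 1).2 (Real.summable_one_div_nat_pow.2 (by norm_num : 1 < 2))
  simpa using this

/-- Up to the error `R`, each summand is `u n - u (n + 1)`, so only `u 0` survives. Since `x ≥ 1/2`,
the sample points satisfy `2δ(n + x) ≥ δ(n + 1)`; summing `1 / (1 + y²)` over them costs a factor
`δ⁻²`, whence `δ^(2N)`. -/
theorem exists_abs_tsum_sub_gaussHalfSum_le {x : ℝ} (hx : 1 / 2 ≤ x) (N : ℕ) :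
    ∃ C : ℝ, ∀ δ, 0 < δ → δ ≤ 1 / 2 →
      |∑' n : ℕ, (-1) ^ n * Real.exp (-(2 * δ ^ 2) * (n + x) ^ 2) -
        gaussHalfSum (N + 1) δ (2 * δ * x - δ)| ≤ C * δ ^ (2 * N) := by
  obtain ⟨C, hC0, hC⟩ := exists_abs_gaussHalfSum_add_sub_le N
  refine ⟨C * ∑' n : ℕ, 1 / ((n : ℝ) + 1) ^ 2, fun δ hδ hδ1 => ?_⟩
  set U := gaussHalfSum (N + 1) δ
  set u : ℕ → ℝ := fun n => (-1) ^ n * U (2 * δ * (n + x) - δ) with hu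
  set R : ℕ → ℝ := fun n => (-1) ^ n * (U (2 * δ * (n + x) + δ) + U (2 * δ * (n + x) - δ) -
    Real.exp (-((2 * δ * (n + x)) ^ 2 / 2))) with hR
  have hRle : ∀ n, ‖R n‖ ≤ C * δ ^ (2 * N) * (1 / ((n : ℝ) + 1) ^ 2) := fun n => by
    rw [hR, norm_mul, norm_pow, norm_neg, norm_one, one_pow, one_mul, Real.norm_eq_abs]
    refine (hC δ hδ hδ1 _).trans ?_
    rw [mul_one_div, div_le_div_iff₀ (by positivity) (by positivity)]
    have h1 : ((n : ℝ) + 1) ^ 2 ≤ (2 * (n + x)) ^ 2 := by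
      gcongr
      have : (0 : ℝ) ≤ n := by positivity
      linarith
    calc _ = C * δ ^ (2 * N) * (δ ^ 2 * ((n : ℝ) + 1) ^ 2) := by ring
      _ ≤ C * δ ^ (2 * N) * (1 + (2 * δ * (n + x)) ^ 2) := by
        gcongr
        nlinarith [sq_nonneg δ]
  have hRs : Summable R :=
    Summable.of_norm_bounded (summable_one_div_nat_succ_sq.mul_left _) hRle
  have hus : Summable u := by
    obtain ⟨D, hD0, hD⟩ := exists_abs_gaussHalfSum_le (N + 1) δ
    rw [← summable_nat_add_iff 1]
    refine Summable.of_norm_bounded (summable_one_div_nat_succ_sq.mul_left (D / δ ^ 2)) fun n => ?_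
    rw [hu, norm_mul, norm_pow, norm_neg, norm_one, one_pow, one_mul, Real.norm_eq_abs]
    refine (hD _).trans ?_
    rw [div_mul_div_comm, mul_one]
    gcongr
    push_cast
    have h1 : δ * ((n : ℝ) + 1) ≤ 2 * δ * (n + 1 + x) - δ := by
      have : (0 : ℝ) ≤ n := by positivity
      nlinarith
    rw [← mul_pow]
    nlinarith [pow_le_pow_left₀ (by positivity) h1 2]
  have hsum : ∑' n : ℕ, (-1) ^ n * Real.exp (-(2 * δ ^ 2) * (n + x) ^ 2) =
      ∑' n, (u n - u (n + 1) - R n) := by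
    refine tsum_congr fun n => ?_
    simp only [hu, hR]
    rw [show (2 : ℝ) * δ * (((n + 1 : ℕ) : ℝ) + x) - δ = 2 * δ * (n + x) + δ by push_cast; ring,
      show -(2 * δ ^ 2) * ((n : ℝ) + x) ^ 2 = -((2 * δ * (n + x)) ^ 2 / 2) by ring, pow_succ]
    ring
  have hus1 : Summable fun n => u (n + 1) := (summable_nat_add_iff 1).2 hus
  rw [hsum, (hus.sub hus1).tsum_sub hRs, hus.tsum_sub hus1, hus.tsum_eq_zero_add]
  have h0 : u 0 = U (2 * δ * x - δ) := by simp [hu]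
  rw [h0, add_sub_cancel_right, sub_right_comm, sub_self, zero_sub, abs_neg]
  calc |∑' n, R n| ≤ ∑' n : ℕ, C * δ ^ (2 * N) * (1 / ((n : ℝ) + 1) ^ 2) :=
        tsum_of_norm_bounded (summable_one_div_nat_succ_sq.mul_left _).hasSum hRle
    _ = _ := by rw [tsum_mul_left]; ring

/-! ### Expansions in `w` for the shifts `1/2` and `1`. -/

/-- The expansion in `w` of `2 ∑ (-1)^n exp (-w (n + 1/2)²)`. -/
noncomputable def alternatingGaussSeries : PowerSeries ℝ :=
  PowerSeries.mk fun k => secSqrtSeries.coeff k * ((2 * k - 1)‼ : ℝ) / 2 ^ k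

theorem two_mul_gaussHalfSum_zero (N : ℕ) (δ : ℝ) :
    2 * gaussHalfSum N δ 0 = (alternatingGaussSeries.trunc N).eval (2 * δ ^ 2) := by
  rw [eval_trunc_eq_sum, gaussHalfSum, ← mul_assoc, show (2 : ℝ) * (1 / 2) = 1 by norm_num, one_mul]
  refine Finset.sum_congr rfl fun k _ => ?_
  rw [gaussDeriv_two_mul_zero, alternatingGaussSeries, PowerSeries.coeff_mk, mul_pow, pow_mul]
  have : ((-1 : ℝ) ^ k) * (-1) ^ k = 1 := by rw [← mul_pow]; simp
  rw [div_mul_eq_mul_div, eq_div_iff (by positivity)]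
  linear_combination 2 ^ k * secSqrtSeries.coeff k * ((2 * k - 1)‼ : ℝ) * (δ ^ 2) ^ k * this

theorem isBigO_of_abs_le_sq {f : ℝ → ℝ} {N : ℕ} {C : ℝ}
    (h : ∀ δ, 0 < δ → δ ≤ 1 / 2 → |f (2 * δ ^ 2)| ≤ C * δ ^ (2 * N)) :
    f =O[𝓝[>] (0 : ℝ)] fun w => w ^ N := by
  refine IsBigO.of_bound (C / 2 ^ N) ?_
  filter_upwards [Ioo_mem_nhdsGT (show (0 : ℝ) < 1 / 2 by norm_num)] with w hw
  have hw0 := hw.1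
  have h1 : √(w / 2) ^ 2 = w / 2 := Real.sq_sqrt (by positivity)
  have h2 := h √(w / 2) (by positivity)
    (Real.sqrt_le_iff.2 ⟨by norm_num, by linarith [hw.2]⟩)
  rw [pow_mul, h1, mul_div_cancel₀ _ (by norm_num : (2 : ℝ) ≠ 0)] at h2
  rw [Real.norm_eq_abs, Real.norm_of_nonneg (by positivity)]
  refine h2.trans (le_of_eq ?_)
  rw [div_pow]; ring

theorem hasSeriesExpansion_tsum_half :
    HasSeriesExpansion (fun w => 2 * ∑' n : ℕ, (-1) ^ n * Real.exp (-w * (n + 1 / 2) ^ 2))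
      alternatingGaussSeries := fun N => by
  obtain ⟨C, hC⟩ := exists_abs_tsum_sub_gaussHalfSum_le (le_refl (1 / 2)) N
  have h1 : (fun w => 2 * (∑' n : ℕ, (-1) ^ n * Real.exp (-w * (n + 1 / 2) ^ 2)) -
      (alternatingGaussSeries.trunc (N + 1)).eval w) =O[𝓝[>] (0 : ℝ)] fun w => w ^ N := by
    refine isBigO_of_abs_le_sq (C := 2 * C) fun δ hδ hδ1 => ?_
    have h := hC δ hδ hδ1
    rw [show 2 * δ * (1 / 2) - δ = 0 by ring] at h
    rw [← two_mul_gaussHalfSum_zero, ← mul_sub, abs_mul, abs_two]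
    linarith
  -- One extra term was kept to offset the lost `δ²`; it is `O(w^N)` and can be dropped.
  refine (h1.add ((isBigO_refl (fun w : ℝ => w ^ N) _).const_mul_left
    (alternatingGaussSeries.coeff N))).congr_left fun w => ?_
  rw [eval_trunc_eq_sum, eval_trunc_eq_sum, Finset.sum_range_succ]
  ring

/-- Here the telescoped value is `U(δ)`. As `U` is even, `2U(δ) = U(δ) + U(-δ)`, which is `exp 0 =
1` up to the allowed error. -/
theorem hasSeriesExpansion_tsum_one :
    HasSeriesExpansion (fun w => 2 * ∑' n : ℕ, (-1) ^ n * Real.exp (-w * (n + 1) ^ 2))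
      (PowerSeries.C 1) := fun N => by
  obtain ⟨C, hC⟩ := exists_abs_tsum_sub_gaussHalfSum_le (by norm_num : (1 / 2 : ℝ) ≤ 1) N
  obtain ⟨D, hD0, hD⟩ := exists_abs_gaussHalfSum_add_sub_le N
  have h1 : (fun w => 2 * (∑' n : ℕ, (-1) ^ n * Real.exp (-w * (n + 1) ^ 2)) - 1)
      =O[𝓝[>] (0 : ℝ)] fun w => w ^ N := by
    refine isBigO_of_abs_le_sq (C := 2 * C + D) fun δ hδ hδ1 => ?_
    have h2 := abs_le.1 (hC δ hδ hδ1)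
    rw [show 2 * δ * 1 - δ = δ by ring] at h2
    have h3 := hD δ hδ hδ1 0
    rw [zero_add, zero_sub, gaussHalfSum_neg] at h3
    have h4 : D * δ ^ (2 * (N + 1)) ≤ D * δ ^ (2 * N) :=
      mul_le_mul_of_nonneg_left
        (pow_le_pow_of_le_one hδ.le (by linarith) (by omega)) hD0
    norm_num at h3 h4
    have h5 := abs_le.1 (h3.trans h4)
    exact abs_le.2 ⟨by linarith [h2.1, h5.1], by linarith [h2.2, h5.2]⟩
  simpa using (h1.add (HasSeriesExpansion.const 1 N))

/-! ### The substitution `w = log ((1 + t) / (1 - t))`. -/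

/-- The power series of `log ((1 + t) / (1 - t))`. -/
noncomputable def logCayleySeries : PowerSeries ℝ := PowerSeries.mk fun n => (1 - (-1) ^ n) / n

theorem coeff_logCayleySeries_nonneg (n : ℕ) : 0 ≤ logCayleySeries.coeff n := by
  rw [logCayleySeries, PowerSeries.coeff_mk]
  rcases neg_one_pow_eq_or ℝ n with h | h <;> rw [h]
  · simp
  · positivity

theorem constantCoeff_logCayleySeries : logCayleySeries.constantCoeff = 0 := by
  simp [logCayleySeries, ← PowerSeries.coeff_zero_eq_constantCoeff_apply]

theorem hasSeriesExpansion_logCayley :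
    HasSeriesExpansion (fun t => Real.log ((1 + t) / (1 - t))) logCayleySeries := by
  refine HasSeriesExpansion.of_hasSum (r := 1 / 2) (by norm_num) fun t ht0 ht1 => ?_
  have h1 := Real.hasSum_pow_div_log_of_abs_lt_one
    (show |t| < 1 by rw [abs_of_pos ht0]; linarith)
  have h2 := Real.hasSum_pow_div_log_of_abs_lt_one
    (show |-t| < 1 by rw [abs_neg, abs_of_pos ht0]; linarith)
  have h3 := h1.sub h2
  rw [← hasSum_nat_add_iff' 1]
  have h4 : Real.log ((1 + t) / (1 - t)) - ∑ i ∈ Finset.range 1, logCayleySeries.coeff i * t ^ i =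
      -Real.log (1 - t) - -Real.log (1 - -t) := by
    rw [Real.log_div (by linarith) (by linarith)]
    simp [constantCoeff_logCayleySeries]
    ring
  rw [h4]
  refine h3.congr_fun fun n => ?_
  rw [logCayleySeries, PowerSeries.coeff_mk, neg_pow t]
  push_cast
  ring

theorem two_pow_le_coeff_logCayleySeries_pow (n : ℕ) :
    2 ^ n ≤ (logCayleySeries ^ n).coeff n := by
  induction n with
  | zero => simp
  | succ n ih =>
    rw [pow_succ logCayleySeries, PowerSeries.coeff_mul]
    have h1 : logCayleySeries.coeff 1 = 2 := by norm_num [logCayleySeries]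
    calc (2 : ℝ) ^ (n + 1) ≤ (logCayleySeries ^ n).coeff n * logCayleySeries.coeff 1 := by
          rw [h1, pow_succ]; linarith
      _ ≤ _ := Finset.single_le_sum
        (f := fun p : ℕ × ℕ => (logCayleySeries ^ n).coeff p.1 * logCayleySeries.coeff p.2)
        (fun i _ => mul_nonneg (coeff_pow_nonneg coeff_logCayleySeries_nonneg _ _)
          (coeff_logCayleySeries_nonneg _)) (by simp : ((n, 1) : ℕ × ℕ) ∈ _)

theorem log_cayley_pos {t : ℝ} (h0 : 0 < t) (h1 : t < 1) : 0 < Real.log ((1 + t) / (1 - t)) :=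
  Real.log_pos ((one_lt_div (by linarith)).2 (by linarith))

theorem HasSeriesExpansion.comp_logCayley {F : ℝ → ℝ} {c : PowerSeries ℝ}
    (hF : HasSeriesExpansion F c) :
    HasSeriesExpansion (fun t => F (Real.log ((1 + t) / (1 - t))))
      (formalComp c logCayleySeries) :=
  hF.comp hasSeriesExpansion_logCayley constantCoeff_logCayleySeries (by
    filter_upwards [Ioo_mem_nhdsGT (show (0 : ℝ) < 1 by norm_num)] with t ht
    exact log_cayley_pos ht.1 ht.2)

theorem formalComp_C (a : ℝ) (W : PowerSeries ℝ) :
    formalComp (PowerSeries.C a) W = PowerSeries.C a := by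
  ext n
  rw [formalComp, PowerSeries.coeff_mk, Finset.sum_eq_single 0]
  · simp [PowerSeries.coeff_C, PowerSeries.coeff_one]
  · intro k _ hk
    simp [PowerSeries.coeff_C, hk]
  · simp

theorem coeff_mul_le_coeff_formalComp {c W : PowerSeries ℝ} (hc : ∀ n, 0 ≤ c.coeff n)
    (hW : ∀ n, 0 ≤ W.coeff n) (n : ℕ) :
    c.coeff n * (W ^ n).coeff n ≤ (formalComp c W).coeff n := by
  rw [formalComp, PowerSeries.coeff_mk]
  exact Finset.single_le_sum (f := fun k => c.coeff k * (W ^ k).coeff n)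
    (fun k _ => mul_nonneg (hc k) (coeff_pow_nonneg hW k n)) (by simp)

theorem coeff_formalComp_nonneg {c W : PowerSeries ℝ} (hc : ∀ n, 0 ≤ c.coeff n)
    (hW : ∀ n, 0 ≤ W.coeff n) (n : ℕ) : 0 ≤ (formalComp c W).coeff n :=
  (mul_nonneg (hc n) (coeff_pow_nonneg hW n n)).trans (coeff_mul_le_coeff_formalComp hc hW n)

/-! ### Completing the square, the recursion in `b`, and the cases `b = 1, 2`. -/

theorem partialTheta_eq (b : ℕ) {t : ℝ} (h0 : 0 < t) (h1 : t < 1) :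
    partialTheta b t = Real.exp (Real.log ((1 + t) / (1 - t)) * (b ^ 2 / 4)) *
      (2 * ∑' n : ℕ, (-1) ^ n *
        Real.exp (-Real.log ((1 + t) / (1 - t)) * (n + (b / 2 : ℝ)) ^ 2)) := by
  have hq : (1 - t) / (1 + t) = Real.exp (-Real.log ((1 + t) / (1 - t))) := by
    rw [Real.exp_neg, Real.exp_log (div_pos (by linarith) (by linarith)), inv_div]
  rw [partialTheta, hq]
  set w := Real.log ((1 + t) / (1 - t))
  rw [mul_left_comm, ← tsum_mul_left (a := Real.exp (w * (b ^ 2 / 4)))]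
  congr 1
  refine tsum_congr fun n => ?_
  rw [mul_left_comm, ← Real.exp_add, ← Real.exp_nat_mul]
  congr 2
  push_cast
  ring

/-- After removing `n = 0`, use `(n+1)² + b(n+1) = (b+1) + n² + (b+2)n`. -/
theorem partialTheta_add_two (b : ℕ) {t : ℝ} (h0 : 0 < t) (h1 : t < 1) :
    partialTheta (b + 2) t = ((1 + t) / (1 - t)) ^ (b + 1) * (2 - partialTheta b t) := by
  have hs := summable_partialTheta b h0 h1
  rw [partialTheta, partialTheta, hs.tsum_eq_zero_add]
  have hq : ((1 + t) / (1 - t)) * ((1 - t) / (1 + t)) = 1 := by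
    have : 1 - t ≠ 0 := by linarith
    have : 1 + t ≠ 0 := by linarith
    field_simp
  set q := (1 - t) / (1 + t)
  set e := (1 + t) / (1 - t)
  have h2 : ∀ n : ℕ, (-1 : ℝ) ^ (n + 1) * q ^ ((n + 1) ^ 2 + b * (n + 1)) =
      -q ^ (b + 1) * ((-1) ^ n * q ^ (n ^ 2 + (b + 2) * n)) := fun n => by
    rw [show (n + 1) ^ 2 + b * (n + 1) = (b + 1) + (n ^ 2 + (b + 2) * n) by ring, pow_add q]
    ring
  simp only [h2, tsum_mul_left]
  have h3 : e ^ (b + 1) * q ^ (b + 1) = 1 := by rw [← mul_pow, hq, one_pow]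
  simp only [pow_zero, one_mul, mul_zero, add_zero, ne_eq, OfNat.ofNat_ne_zero, not_false_eq_true,
    zero_pow]
  linear_combination (-2 * ∑' n : ℕ, (-1) ^ n * q ^ (n ^ 2 + (b + 2) * n)) * h3

/-- The power series of `exp (w / 4)`. -/
noncomputable def expQuarterSeries : PowerSeries ℝ := PowerSeries.mk fun k => (1 / 4) ^ k / (k ! : ℝ)

theorem hasSeriesExpansion_expQuarter :
    HasSeriesExpansion (fun w => Real.exp (w * (1 / 4))) expQuarterSeries := by
  refine HasSeriesExpansion.of_hasSum one_pos fun w _ _ => ?_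
  have h := NormedSpace.expSeries_div_hasSum_exp (w * (1 / 4))
  rw [← Real.exp_eq_exp_ℝ] at h
  refine h.congr_fun fun n => ?_
  rw [expQuarterSeries, PowerSeries.coeff_mk, mul_pow]
  ring

theorem factorial_le_doubleFactorial (k : ℕ) : k ! ≤ (2 * k - 1)‼ := by
  induction k with
  | zero => simp
  | succ k ih =>
    rcases Nat.eq_zero_or_pos k with rfl | hk
    · simp
    · rw [show 2 * (k + 1) - 1 = (2 * k - 1) + 2 by omega, Nat.doubleFactorial_add_two,
        Nat.factorial_succ]
      exact Nat.mul_le_mul (by omega) ih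

theorem coeff_alternatingGaussSeries_ge (n : ℕ) :
    (1 / 8) ^ n * (n ! : ℝ) ≤ alternatingGaussSeries.coeff n := by
  rw [alternatingGaussSeries, PowerSeries.coeff_mk]
  have h1 : (n ! : ℝ) ≤ ((2 * n - 1)‼ : ℝ) := by exact_mod_cast factorial_le_doubleFactorial n
  calc (1 / 8) ^ n * (n ! : ℝ) = (1 / 4) ^ n * (n ! : ℝ) / 2 ^ n := by
        rw [show (1 / 8 : ℝ) = 1 / 4 * (1 / 2) by norm_num, mul_pow, one_div_pow 2]; ring
    _ ≤ _ := by
      have h2 := coeff_secSqrtSeries_ge n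
      have h3 : 0 ≤ secSqrtSeries.coeff n := (by positivity : (0 : ℝ) ≤ (1 / 4) ^ n).trans h2
      gcongr

/-- The asymptotic expansion of `partialTheta 1`. -/
noncomputable def thetaOneSeries : PowerSeries ℝ :=
  formalComp (expQuarterSeries * alternatingGaussSeries) logCayleySeries

theorem hasSeriesExpansion_partialTheta_one :
    HasSeriesExpansion (partialTheta 1) thetaOneSeries := by
  refine (hasSeriesExpansion_expQuarter.mul hasSeriesExpansion_tsum_half).comp_logCayley.congr' ?_
  filter_upwards [Ioo_mem_nhdsGT (show (0 : ℝ) < 1 by norm_num)] with t ht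
  rw [partialTheta_eq 1 ht.1 ht.2]
  norm_num

theorem hasSeriesExpansion_partialTheta_two :
    HasSeriesExpansion (partialTheta 2) cayleySeries := by
  have h := hasSeriesExpansion_tsum_one.comp_logCayley
  rw [formalComp_C, map_one] at h
  have h2 := hasSeriesExpansion_cayley.mul h
  rw [mul_one] at h2
  refine h2.congr' ?_
  filter_upwards [Ioo_mem_nhdsGT (show (0 : ℝ) < 1 by norm_num)] with t ht
  rw [partialTheta_eq 2 ht.1 ht.2]
  norm_num
  rw [Real.exp_log (div_pos (by linarith [ht.1]) (by linarith [ht.2]))]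
  exact Or.inl rfl

theorem coeff_thetaOneSeries_nonneg_and_ge (n : ℕ) :
    0 ≤ thetaOneSeries.coeff n ∧ (1 / 4) ^ n * (n ! : ℝ) ≤ thetaOneSeries.coeff n := by
  have hE : ∀ n, 0 ≤ expQuarterSeries.coeff n := fun n => by
    rw [expQuarterSeries, PowerSeries.coeff_mk]; positivity
  have hA : ∀ n, 0 ≤ alternatingGaussSeries.coeff n := fun n =>
    (by positivity : (0 : ℝ) ≤ (1 / 8) ^ n * (n ! : ℝ)).trans (coeff_alternatingGaussSeries_ge n)
  have hEA := coeff_mul_nonneg hE hA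
  refine ⟨coeff_formalComp_nonneg hEA coeff_logCayleySeries_nonneg n,
    le_trans ?_ (coeff_mul_le_coeff_formalComp hEA coeff_logCayleySeries_nonneg n)⟩
  have h1 := (coeff_alternatingGaussSeries_ge n).trans
    (coeff_le_coeff_mul hE (by simp [expQuarterSeries]) hA n)
  calc (1 / 4) ^ n * (n ! : ℝ) = (1 / 8) ^ n * (n ! : ℝ) * 2 ^ n := by
        rw [show (1 / 4 : ℝ) = 1 / 8 * 2 by norm_num, mul_pow]; ring
    _ ≤ _ := mul_le_mul h1 (two_pow_le_coeff_logCayleySeries_pow n) (by positivity) (hEA n)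

/-! ### Iterating the recursion and comparing growth. -/

theorem HasSeriesExpansion.partialTheta_add_two {b : ℕ} {P : PowerSeries ℝ}
    (h : HasSeriesExpansion (partialTheta b) P) :
    HasSeriesExpansion (partialTheta (b + 2)) (cayleySeries ^ (b + 1) * (PowerSeries.C 2 - P)) := by
  refine ((hasSeriesExpansion_cayley.pow (b + 1)).mul
    ((HasSeriesExpansion.const 2).sub h)).congr' ?_
  filter_upwards [Ioo_mem_nhdsGT (show (0 : ℝ) < 1 by norm_num)] with t ht
  rw [_root_.partialTheta_add_two b ht.1 ht.2]

/-- The same `K` serves the main term and the error `J`: each step multiplies both by `cayleySeries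
^ a`, and the constant `2` adds only `2 * cayleySeries ^ a` to the domination. The `M` extra factors
of the main term are thus never lost. -/
theorem exists_hasSeriesExpansion_partialTheta {b M : ℕ} {B : PowerSeries ℝ}
    (h : HasSeriesExpansion (partialTheta b) (cayleySeries ^ M * B)) (m : ℕ) :
    ∃ (J : PowerSeries ℝ) (c : ℝ) (K : ℕ), 0 ≤ c ∧
      (∀ n, |J.coeff n| ≤ c * (cayleySeries ^ K).coeff n) ∧
      HasSeriesExpansion (partialTheta (b + 2 * m))
        (PowerSeries.C ((-1) ^ m) * (cayleySeries ^ (M + K) * B + J)) := by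
  induction m with
  | zero => exact ⟨0, 0, 0, le_rfl, fun n => by simp, by simpa using h⟩
  | succ m ih =>
    obtain ⟨J, c, K, hc, hJ, hP⟩ := ih
    set a := b + 2 * m + 1 with ha
    refine ⟨cayleySeries ^ a * J - PowerSeries.C (2 * (-1) ^ m) * cayleySeries ^ a,
      c + 2, K + a, by positivity, fun n => ?_, ?_⟩
    · have h1 := abs_coeff_mul_le (coeff_cayleySeries_pow_nonneg a) hJ n
      rw [← pow_add, add_comm a K] at h1
      have h2 := coeff_cayleySeries_pow_mono (Nat.le_add_left a K) n
      have h3 : |(PowerSeries.C (2 * (-1) ^ m) * cayleySeries ^ a).coeff n| ≤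
          2 * (cayleySeries ^ (K + a)).coeff n := by
        rw [PowerSeries.coeff_C_mul, abs_mul, abs_mul, abs_pow, abs_neg, abs_one, one_pow, abs_two,
          abs_of_nonneg (coeff_cayleySeries_pow_nonneg a n)]
        linarith
      rw [map_sub]
      refine (abs_sub _ _).trans ?_
      linarith
    · have h4 := hP.partialTheta_add_two
      have h5 : (PowerSeries.C ((-1 : ℝ) ^ m)) * PowerSeries.C ((-1 : ℝ) ^ m) = 1 := by
        rw [← map_mul, ← mul_pow]; simp
      rw [show b + 2 * (m + 1) = b + 2 * m + 2 by ring]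
      convert h4 using 1
      simp only [pow_succ (-1 : ℝ) m, mul_neg, mul_one, map_neg, map_mul, ← add_assoc M K a,
        pow_add cayleySeries (M + K) a, ← ha]
      linear_combination PowerSeries.C 2 * cayleySeries ^ a * h5

/-- `(1/4)^n n!` outgrows `|c| (4^K)^n`. -/
theorem eventually_coeff_thetaOne_gt (c : ℝ) (K : ℕ) :
    ∀ᶠ n in atTop, c * (cayleySeries ^ K).coeff n < (cayleySeries ^ K * thetaOneSeries).coeff n := by
  have h := (FloorSemiring.tendsto_pow_div_factorial_atTop ((4 : ℝ) ^ K * 4)).const_mul |c|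
  rw [mul_zero] at h
  filter_upwards [h.eventually (gt_mem_nhds one_pos)] with n hn
  have h1 := coeff_le_coeff_mul (coeff_cayleySeries_pow_nonneg K)
    (one_le_coeff_zero_cayleySeries_pow K) (fun n => (coeff_thetaOneSeries_nonneg_and_ge n).1) n
  have hf : (0 : ℝ) < n ! := by positivity
  rw [← mul_div_assoc, div_lt_one hf, mul_pow] at hn
  calc c * (cayleySeries ^ K).coeff n ≤ |c| * (cayleySeries ^ K).coeff n :=
        mul_le_mul_of_nonneg_right (le_abs_self c) (coeff_cayleySeries_pow_nonneg K n)
    _ ≤ |c| * (4 ^ K) ^ n :=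
        mul_le_mul_of_nonneg_left (coeff_cayleySeries_pow_le K n) (abs_nonneg c)
    _ = (1 / 4) ^ n * (|c| * ((4 ^ K) ^ n * 4 ^ n)) := by
        rw [one_div_pow]; field_simp
    _ < (1 / 4) ^ n * (n ! : ℝ) := mul_lt_mul_of_pos_left hn (by positivity)
    _ ≤ _ := (coeff_thetaOneSeries_nonneg_and_ge n).2.trans h1

theorem eventually_coeff_cayleySeries_pow_succ_gt {c : ℝ} (hc : 0 ≤ c) (K : ℕ) :
    ∀ᶠ n in atTop, c * (cayleySeries ^ K).coeff n < (cayleySeries ^ (K + 1)).coeff n := by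
  obtain ⟨n₀, hn₀⟩ := exists_nat_gt (2 * K * c)
  filter_upwards [eventually_ge_atTop (max n₀ 1)] with n hn
  by_contra! hlt
  have h1 := natCast_mul_coeff_cayleySeries_pow_le K n
  have h2 := coeff_cayleySeries_pow_nonneg K n
  have h3 : (n₀ : ℝ) ≤ n := by exact_mod_cast (le_max_left _ _).trans hn
  have h4 : 2 ≤ (cayleySeries ^ (K + 1)).coeff n := by
    have h := coeff_cayleySeries_pow_mono (Nat.le_add_left 1 K) n
    have hn0 : n ≠ 0 := by have := (le_max_right n₀ 1).trans hn; omega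
    rwa [pow_one, cayleySeries, PowerSeries.coeff_mk, if_neg hn0, ← cayleySeries] at h
  have h5 : 2 * K * (cayleySeries ^ (K + 1)).coeff n ≤
      2 * K * (c * (cayleySeries ^ K).coeff n) := by gcongr
  -- If the inequality failed, a positive coefficient `a` of `cayleySeries ^ K` would satisfy `n * a
  -- ≤ 2 * K * c * a` with `n > 2 * K * c`. So `a ≤ 0`, contradicting the lower bound `2` in `h4`.
  have h6 : (cayleySeries ^ K).coeff n ≤ 0 := by
    by_contra! hpos
    nlinarith
  nlinarith

theorem exists_hasSeriesExpansion_eventually_pos (b M : ℕ) {B : PowerSeries ℝ}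
    (h : HasSeriesExpansion (partialTheta b) (cayleySeries ^ M * B))
    (hB : ∀ c : ℝ, 0 ≤ c → ∀ K, ∀ᶠ n in atTop,
      c * (cayleySeries ^ K).coeff n < (cayleySeries ^ (M + K) * B).coeff n) (m : ℕ) :
    ∃ Q : PowerSeries ℝ, (∀ᶠ n in atTop, 0 < Q.coeff n) ∧
      HasSeriesExpansion (partialTheta (b + 2 * m)) (PowerSeries.C ((-1) ^ m) * Q) := by
  obtain ⟨J, c, K, hc, hJ, hP⟩ := exists_hasSeriesExpansion_partialTheta h m
  refine ⟨_, ?_, hP⟩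
  filter_upwards [hB c hc K] with n hn
  rw [map_add]
  linarith [neg_abs_le (J.coeff n), hJ n]

theorem exists_hasSeriesExpansion_odd (m : ℕ) :
    ∃ Q : PowerSeries ℝ, (∀ᶠ n in atTop, 0 < Q.coeff n) ∧
      HasSeriesExpansion (partialTheta (1 + 2 * m)) (PowerSeries.C ((-1) ^ m) * Q) :=
  exists_hasSeriesExpansion_eventually_pos 1 0 (B := thetaOneSeries)
    (by simpa using hasSeriesExpansion_partialTheta_one)
    (fun c _ K => by simpa using eventually_coeff_thetaOne_gt c K) m

theorem exists_hasSeriesExpansion_even (m : ℕ) :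
    ∃ Q : PowerSeries ℝ, (∀ᶠ n in atTop, 0 < Q.coeff n) ∧
      HasSeriesExpansion (partialTheta (2 + 2 * m)) (PowerSeries.C ((-1) ^ m) * Q) :=
  exists_hasSeriesExpansion_eventually_pos 2 1 (B := 1)
    (by simpa using hasSeriesExpansion_partialTheta_two)
    (fun c hc K => by simpa [add_comm 1 K] using eventually_coeff_cayleySeries_pow_succ_gt hc K) m

theorem exists_hasSeriesExpansion_sign (b : ℕ) (hb : 0 < b) :
    ∃ Q : PowerSeries ℝ, (∀ᶠ n in atTop, 0 < Q.coeff n) ∧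
      HasSeriesExpansion (partialTheta b)
        (PowerSeries.C (if b % 4 = 1 ∨ b % 4 = 2 then 1 else -1) * Q) := by
  obtain ⟨m, r, hr, rfl⟩ : ∃ m r, (r = 1 ∨ r = 2) ∧ b = r + 2 * m := by
    rcases Nat.even_or_odd' b with ⟨k, hk | hk⟩
    -- Since `b > 0`, here `k ≥ 1` and the subtraction is exact.
    · exact ⟨k - 1, 2, Or.inr rfl, by omega⟩
    · exact ⟨k, 1, Or.inl rfl, by omega⟩
  have hs : (if (r + 2 * m) % 4 = 1 ∨ (r + 2 * m) % 4 = 2 then (1 : ℝ) else -1) = (-1) ^ m := by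
    rcases Nat.even_or_odd m with hm | hm
    · rw [hm.neg_one_pow, if_pos]
      obtain ⟨k, rfl⟩ := hm
      omega
    · rw [hm.neg_one_pow, if_neg]
      obtain ⟨k, rfl⟩ := hm
      omega
  rw [hs]
  rcases hr with rfl | rfl
  · exact exists_hasSeriesExpansion_odd m
  · exact exists_hasSeriesExpansion_even m

theorem theorem1 (b : ℕ) (hb : 0 < b) :
    (∃! a : ℕ → ℝ, HasAsymptoticExpansion (partialTheta b) a) ∧
    ∀ a : ℕ → ℝ, HasAsymptoticExpansion (partialTheta b) a →
      ((∀ᶠ n in atTop, 0 < a n) ∨ (∀ᶠ n in atTop, a n < 0)) ∧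
      ((b ≡ 1 [MOD 4] ∨ b ≡ 2 [MOD 4]) → ∀ᶠ n in atTop, 0 < a n) ∧
      ((b ≡ 0 [MOD 4] ∨ b ≡ 3 [MOD 4]) → ∀ᶠ n in atTop, a n < 0) := by
  obtain ⟨Q, hQ, hP⟩ := exists_hasSeriesExpansion_sign b hb
  have hA := hasAsymptoticExpansion_iff.2 hP
  refine ⟨⟨_, hA, fun a ha => ha.unique hA⟩, fun a ha => ?_⟩
  obtain rfl := ha.unique hA
  simp only [PowerSeries.coeff_C_mul, Nat.ModEq]
  by_cases h : b % 4 = 1 ∨ b % 4 = 2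
  · rw [if_pos h]
    have hpos : ∀ᶠ n in atTop, 0 < 1 * Q.coeff n := by simpa using hQ
    exact ⟨Or.inl hpos, fun _ => hpos, fun h' => by omega⟩
  · rw [if_neg h]
    have hneg : ∀ᶠ n in atTop, -1 * Q.coeff n < 0 := by simpa using hQ
    exact ⟨Or.inr hneg, fun h' => by omega, fun _ => hneg⟩
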